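/- Let $(\Omega,\Sigma)$ be a measurable space and let $X$ be a real Banach space with dual $X^*$. By a subspace of a Banach space we mean a norm-closed linear subspace. Let $c_0(\omega_1)$ be the Banach space of all families $(a_\alpha)_{\alpha<\omega_1}$ of real numbers such that $\{\alpha<\omega_1:|a_\alpha|\ge\varepsilon\}$ is finite for every $\varepsilon>0$, with the supremum norm, where $\omega_1$ is the first uncountable ordinal. Suppose that $X$ contains no subspace isomorphic (linearly homeomorphic) to $c_0(\omega_1)$. Let $Z\subseteq X^*$ be a norming subspace, i.e. a subspace such that $|||x|||:=\sup\{|x^*(x)|: x^*\in Z,\ \|x^*\|\le 1\}$ defines an equivalent norm on $X$. Let $M$ be a map assigning to each $A\in\Sigma$ a bounded non-empty set $M(A)\subseteq X$, such that for every $x^*\in Z$ the function $$s(x^*,M):\Sigma\to\mathbb R,\qquad s(x^*,M)(A):=\sup\{x^*(x): x\in M(A)\},$$ is a countably additive real-valued measure on $\Sigma$. Then $M$ admits a control measure: there is a finite non-negative countably additive measure $\mu$ on $\Sigma$ such that $M(A)=\{0\}$ for every $A\in\Sigma$ with $\mu(A)=0$. -/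

import Mathlib

open MeasureTheory
open scoped ENNReal Topology Ordinal

/-- The Banach space `c₀(Γ)` over `ℝ`: all families `f : Γ → ℝ` such that `{i | ε ≤ |f i|}` is
finite for every `ε > 0`, as a subspace of `ℓ_∞(Γ)` with the supremum norm. -/
def cZero (Γ : Type*) : Submodule ℝ (lp (fun _ : Γ => ℝ) ∞) where
  carrier := {f | Filter.Tendsto (fun i => f i) Filter.cofinite (𝓝 0)}
  zero_mem' := tendsto_const_nhds
  add_mem' := fun {f g} hf hg => by
    have h := Filter.Tendsto.add hf hg
    rw [add_zero] at h
    exact h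
  smul_mem' := fun c f hf => by
    have h := Filter.Tendsto.const_mul c hf
    rw [mul_zero] at h
    exact h

/-- The Banach space `X` contains a subspace (a norm-closed linear subspace) which is
isomorphic, i.e. linearly homeomorphic, to `E`. -/
def ContainsIsomorphicCopy (X E : Type*) [NormedAddCommGroup X] [NormedSpace ℝ X]
    [NormedAddCommGroup E] [NormedSpace ℝ E] : Prop :=
  ∃ Y : Submodule ℝ X, IsClosed (Y : Set X) ∧ Nonempty (E ≃L[ℝ] Y)

section

variable {X : Type*} [NormedAddCommGroup X] [NormedSpace ℝ X]

/-- `|||x||| = sup {|x*(x)| : x* ∈ Z, ‖x*‖ ≤ 1}`. -/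
noncomputable def normingValue (Z : Submodule ℝ (StrongDual ℝ X)) (x : X) : ℝ :=
  sSup {r : ℝ | ∃ f ∈ Z, ‖f‖ ≤ 1 ∧ r = |f x|}

/-- `Z` is norming: `|||·|||` is a norm on `X` equivalent to the original one. -/
def IsNorming (Z : Submodule ℝ (StrongDual ℝ X)) : Prop :=
  ∃ c C : ℝ, 0 < c ∧ 0 < C ∧
    ∀ x : X, c * ‖x‖ ≤ normingValue Z x ∧ normingValue Z x ≤ C * ‖x‖

/-- `s(x*, C) = sup {x*(x) : x ∈ C}`. -/
noncomputable def supportValue (f : StrongDual ℝ X) (C : Set X) : ℝ :=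
  sSup ((fun x => f x) '' C)

variable {Ω : Type*} [MeasurableSpace Ω]

/-- The restriction of `φ` to the `σ`-algebra of `Ω` is a countably additive real-valued
measure. -/
def IsCountablyAdditive (φ : Set Ω → ℝ) : Prop :=
  ∃ ν : SignedMeasure Ω, ∀ A : Set Ω, MeasurableSet A → ν A = φ A

/-- The finite non-negative measure `μ` is a control measure of the set-valued map `M`. -/
def IsControlMeasure (μ : Measure Ω) (M : Set Ω → Set X) : Prop :=
  IsFiniteMeasure μ ∧ ∀ A : Set Ω, MeasurableSet A → μ A = 0 → M A = {0}

end

/-!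
For `f ∈ Z` let `ν f` be the signed measure `A ↦ sup f (M A)`. As `M A` is non-empty and `Z`
separates the points of `X`, a control measure is a finite measure whose null sets are null for
the total variation of every `ν f`, and it suffices to find countably many `f` whose total
variations dominate all the others.

If every disjoint family of measurable sets charged by some `|ν f|` is countable, such a countable
subfamily exists by an exhaustion argument (`exists_countable_dominating`).

Otherwise there are uncountably many disjoint sets `B i` and points `x i ∈ M (B i)` with
functionals `f i` of bounded norms such that `f i (x i) = 1`.
Since `|g (x i)| ≤ |ν g (B i)| + |ν (-g) (B i)|`, each `g ∈ Z` is absolutely summable along `x`.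
The uniform boundedness principle on the Banach space `Z` turns this into an upper `c₀`-estimate
for `x` (`IsNorming.exists_norm_sum_smul_le`), so the rows of the matrix `f i (x j)` are absolutely
summable with a common bound. Rosenthal's disjointification lemma (`exists_injective_tsum_le`)
makes the off-diagonal row sums at most `1 / 2` on a subfamily of the same cardinality, and then
`a ↦ ∑ aᵢ xᵢ` embeds `c₀(ω₁)` into `X` (`containsIsomorphicCopy_cZero`), contrary to the
hypothesis.
-/

/-! ### Domination of a family of measures under the countable chain condition -/

section Domination

variable {Ω : Type*} [MeasurableSpace Ω]

theorem exists_maximal_pairwiseDisjoint {α : Type*} (P : Set α → Prop) :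
    ∃ S : Set (Set α), (∀ A ∈ S, P A) ∧ S.PairwiseDisjoint id ∧
      ∀ B, P B → (∀ A ∈ S, Disjoint B A) → B ∈ S := by
  obtain ⟨S, hS⟩ := zorn_subset {S : Set (Set α) | (∀ A ∈ S, P A) ∧ S.PairwiseDisjoint id} (by
    intro c hc hchain
    refine ⟨⋃₀ c, ⟨?_, ?_⟩, fun s hs => Set.subset_sUnion_of_mem hs⟩
    · rintro A ⟨s, hs, hA⟩
      exact (hc hs).1 A hA
    · exact (Set.pairwiseDisjoint_sUnion hchain.directedOn).2 fun s hs => (hc hs).2)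
  refine ⟨S, hS.prop.1, hS.prop.2, fun B hB hd => ?_⟩
  refine hS.le_of_ge (y := insert B S) ⟨?_, ?_⟩ (Set.subset_insert B S) (Set.mem_insert B S)
  · rintro A (rfl | hA)
    exacts [hB, hS.prop.1 A hA]
  · exact hS.prop.2.insert fun A hA _ => hd A hA

/-- A form of the Halmos–Savage theorem: if every disjoint family of sets charged by some `μ i` is
countable, then countably many of the `μ i` already have all the common null sets. No finiteness of
the `μ i` is needed, since the chain condition gives each of them a support, and countably many of
these supports exhaust the union of all of them up to a common null set. -/
theorem exists_countable_dominating {ι : Type*} (μ : ι → Measure Ω)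
    (hccc : ∀ S : Set (Set Ω), (∀ A ∈ S, MeasurableSet A ∧ ∃ i, μ i A ≠ 0) →
      S.PairwiseDisjoint id → S.Countable) :
    ∃ J : Set ι, J.Countable ∧
      ∀ A, MeasurableSet A → (∀ j ∈ J, μ j A = 0) → ∀ i, μ i A = 0 := by
  -- `U i` is the complement of the support of `μ i`: a `μ i`-null set outside of which every
  -- `μ i`-null set is null for all the measures.
  have hsupp : ∀ i, ∃ U, MeasurableSet U ∧ μ i U = 0 ∧
      ∀ B, MeasurableSet B → Disjoint B U → μ i B = 0 → ∀ k, μ k B = 0 := by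
    intro i
    obtain ⟨S, hSP, hSd, hSmax⟩ := exists_maximal_pairwiseDisjoint
      fun A => MeasurableSet A ∧ (∃ k, μ k A ≠ 0) ∧ μ i A = 0
    have hSc : S.Countable := hccc S (fun A hA => ⟨(hSP A hA).1, (hSP A hA).2.1⟩) hSd
    refine ⟨⋃₀ S, .sUnion hSc fun A hA => (hSP A hA).1,
      (measure_sUnion_null_iff hSc).2 fun A hA => (hSP A hA).2.2, fun B hB hBd hiB k => ?_⟩
    by_contra hk
    have hmem := hSmax B ⟨hB, ⟨k, hk⟩, hiB⟩ (Set.disjoint_sUnion_right.1 hBd)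
    have hempty : B = ∅ := disjoint_self.1 (Set.disjoint_sUnion_right.1 hBd B hmem)
    simp [hempty] at hk
  choose U hUm hU0 hUmax using hsupp
  -- A maximal disjoint family of charged sets, each inside the support of some `μ i`.
  obtain ⟨S, hSP, hSd, hSmax⟩ := exists_maximal_pairwiseDisjoint
    fun A => (MeasurableSet A ∧ ∃ k, μ k A ≠ 0) ∧ ∃ i, Disjoint A (U i)
  have hSc : S.Countable := hccc S (fun A hA => (hSP A hA).1) hSd
  choose j hj using fun A hA => (hSP A hA).2
  have : Countable S := hSc.to_subtype
  refine ⟨Set.range fun D : S => j D D.2, Set.countable_range _, fun A hA hJ i => ?_⟩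
  have hD : ∀ D ∈ S, μ i (A ∩ D) = 0 := fun D hD =>
    hUmax (j D hD) (A ∩ D) (hA.inter (hSP D hD).1.1) ((hj D hD).mono_left Set.inter_subset_right)
      (measure_mono_null Set.inter_subset_left (hJ (j D hD) ⟨⟨D, hD⟩, rfl⟩)) i
  have hSm : MeasurableSet (⋃₀ S) := .sUnion hSc fun D hD => (hSP D hD).1.1
  have hin : μ i (A ∩ ⋃₀ S) = 0 := by
    rw [Set.sUnion_eq_biUnion, Set.inter_iUnion₂]
    exact (measure_biUnion_null_iff hSc).2 hD
  have hout : μ i ((A \ ⋃₀ S) \ U i) = 0 := by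
    by_contra hne
    have hd : Disjoint ((A \ ⋃₀ S) \ U i) (⋃₀ S) :=
      Set.disjoint_sdiff_left.mono_left Set.sdiff_subset
    have hmem := hSmax _ ⟨⟨(hA.diff hSm).diff (hUm i), i, hne⟩, i, Set.disjoint_sdiff_left⟩
      (Set.disjoint_sUnion_right.1 hd)
    have hempty := disjoint_self.1 (Set.disjoint_sUnion_right.1 hd _ hmem)
    rw [hempty] at hne
    simp at hne
  refine measure_mono_null (t := (A ∩ ⋃₀ S) ∪ (((A \ ⋃₀ S) \ U i) ∪ U i)) ?_
    (measure_union_null hin (measure_union_null hout (hU0 i)))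
  intro t ht
  by_cases h1 : t ∈ ⋃₀ S
  · exact .inl ⟨ht, h1⟩
  · by_cases h2 : t ∈ U i
    · exact .inr (.inr h2)
    · exact .inr (.inl ⟨⟨ht, h1⟩, h2⟩)

end Domination

/-! ### Disjointification of matrices with bounded rows -/

section Disjointification

/-- Rosenthal's disjointification lemma: a nonnegative matrix on an infinite set `Γ` with zero
diagonal and bounded row sums has a submatrix, indexed by a set equipotent to `Γ`, with row sums at
most `δ`. Split `Γ` into `Γ`-many copies of itself. Either one copy will do, or each copy contains a
row whose sum over that copy exceeds `δ`; choosing one such row in each copy lowers the bound on the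
row sums by `δ`, and this can happen only finitely often. -/
theorem exists_injective_tsum_le {Γ : Type*} [Infinite Γ] {δ : ℝ≥0∞} (hδ : δ ≠ ∞) (n : ℕ)
    (K : Γ → Γ → ℝ≥0∞) (hdiag : ∀ α, K α α = 0) (hK : ∀ α, ∑' β, K α β ≤ n * δ) :
    ∃ e : Γ → Γ, Function.Injective e ∧ ∀ α, ∑' β, K (e α) (e β) ≤ δ := by
  induction n generalizing K with
  | zero => exact ⟨id, Function.injective_id, fun α => (hK α).trans (by simp)⟩
  | succ n ih =>
    obtain ⟨φ⟩ : Nonempty (Γ × Γ ≃ Γ) := Cardinal.eq.1 (by simp)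
    by_cases hgood : ∃ i, ∀ α, ∑' β, K (φ (i, α)) (φ (i, β)) ≤ δ
    · obtain ⟨i, hi⟩ := hgood
      exact ⟨fun α => φ (i, α), fun α β h => by simpa using h, hi⟩
    · push Not at hgood
      choose a ha using hgood
      have hinj : Function.Injective fun i => φ (i, a i) := fun i j h => by
        simpa using congrArg Prod.fst (φ.injective h)
      obtain ⟨e, he, hes⟩ := ih (fun i j => K (φ (i, a i)) (φ (j, a j))) (fun i => hdiag _) (by
        intro i
        classical
        -- The transversal `j ↦ φ (j, a j)` meets the `i`-th copy only in `φ (i, a i)`, where this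
        -- row vanishes, so the two sums below do not overlap.
        have hrow : ∑' j, K (φ (i, a i)) (φ (j, a j)) + ∑' β, K (φ (i, a i)) (φ (i, β))
            ≤ (n + 1 : ℕ) * δ := by
          refine le_trans ?_ (hK (φ (i, a i)))
          rw [← φ.tsum_eq (K (φ (i, a i))), ENNReal.tsum_prod',
            ← tsum_pi_single i (∑' β, K (φ (i, a i)) (φ (i, β))), ← ENNReal.tsum_add]
          refine ENNReal.tsum_le_tsum fun j => ?_
          by_cases hj : j = i
          · subst hj
            simp [hdiag]
          · simp only [Pi.single_apply, hj, if_false, add_zero]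
            exact ENNReal.le_tsum (f := fun b => K (φ (i, a i)) (φ (j, b))) (a j)
        have h := (add_le_add_right (ha i).le _).trans hrow
        rw [Nat.cast_add, Nat.cast_one, add_mul, one_mul] at h
        exact (ENNReal.add_le_add_iff_right hδ).1 h)
      exact ⟨_, hinj.comp he, hes⟩

end Disjointification

/-! ### Families spanning a copy of `c₀` -/

section CZero

variable {Γ X : Type*} [NormedAddCommGroup X] [NormedSpace ℝ X]

theorem isClosed_cZero : IsClosed (cZero Γ : Set (lp (fun _ : Γ => ℝ) ∞)) := by
  refine isClosed_of_closure_subset fun f hf => ?_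
  change Filter.Tendsto (fun i => f i) Filter.cofinite (𝓝 0)
  rw [Metric.tendsto_nhds]
  intro ε hε
  obtain ⟨g, hg, hfg⟩ := Metric.mem_closure_iff.1 hf (ε / 2) (half_pos hε)
  have hg' : Filter.Tendsto (fun i => g i) Filter.cofinite (𝓝 0) := hg
  filter_upwards [Metric.tendsto_nhds.1 hg' (ε / 2) (half_pos hε)] with i hi
  have h := lp.norm_apply_le_norm ENNReal.top_ne_zero (f - g) i
  rw [← dist_eq_norm, lp.coeFn_sub, Pi.sub_apply, ← dist_eq_norm] at h
  linarith [dist_triangle (f i) (g i) 0]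

theorem summable_smul_of_mem_cZero [CompleteSpace X] {x : Γ → X} {C : ℝ}
    (hx : ∀ (F : Finset Γ) (a : Γ → ℝ) (r : ℝ), (∀ i ∈ F, |a i| ≤ r) → 0 ≤ r →
      ‖∑ i ∈ F, a i • x i‖ ≤ C * r) (a : cZero Γ) :
    Summable fun i => a.1 i • x i := by
  have hC : 0 ≤ C := by simpa using hx ∅ 0 1 (by simp) zero_le_one
  rw [summable_iff_vanishing_norm]
  intro ε hε
  have ha : Filter.Tendsto (fun i => a.1 i) Filter.cofinite (𝓝 0) := a.2
  have hr : 0 < ε / (C + 1) := by positivity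
  have hfin := Filter.eventually_cofinite.1 (Metric.tendsto_nhds.1 ha _ hr)
  refine ⟨hfin.toFinset, fun F hF => (hx F _ (ε / (C + 1)) (fun i hi => ?_) hr.le).trans_lt ?_⟩
  · by_contra hlt
    refine Finset.disjoint_left.1 hF hi (hfin.mem_toFinset.2 fun h => hlt ?_)
    simpa using h.le
  · rw [mul_div_assoc', div_lt_iff₀ (by positivity)]
    nlinarith

/-- If `x` satisfies an upper `c₀`-estimate and bounded functionals `f i` with `f i (x i) = 1` are
almost biorthogonal to it, then `a ↦ ∑ aᵢ xᵢ` is an isomorphism of `c₀(Γ)` onto a closed subspace: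
`f i` recovers `aᵢ` up to the error `‖a‖ / 2`. -/
theorem containsIsomorphicCopy_cZero [CompleteSpace X] {x : Γ → X} {f : Γ → StrongDual ℝ X}
    {C D : ℝ}
    (hx : ∀ (F : Finset Γ) (a : Γ → ℝ) (r : ℝ), (∀ i ∈ F, |a i| ≤ r) → 0 ≤ r →
      ‖∑ i ∈ F, a i • x i‖ ≤ C * r)
    (hf : ∀ i, ‖f i‖ ≤ D) (hfx : ∀ i, f i (x i) = 1)
    (hoff : ∀ i (F : Finset Γ), i ∉ F → ∑ j ∈ F, |f i (x j)| ≤ 1 / 2) :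
    ContainsIsomorphicCopy X (cZero Γ) := by
  classical
  have hsum := summable_smul_of_mem_cZero hx
  have hcoord : ∀ (a : cZero Γ) i, |a.1 i| ≤ ‖a‖ := fun a i =>
    lp.norm_apply_le_norm ENNReal.top_ne_zero a.1 i
  let T₀ : cZero Γ →ₗ[ℝ] X :=
    { toFun := fun a => ∑' i, a.1 i • x i
      map_add' := fun a b => by
        rw [← (hsum a).tsum_add (hsum b)]
        exact tsum_congr fun i => add_smul _ _ _
      map_smul' := fun c a => by
        rw [RingHom.id_apply, ← (hsum a).tsum_const_smul c]
        exact tsum_congr fun i => mul_smul _ _ _ }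
  let T : cZero Γ →L[ℝ] X := T₀.mkContinuous C fun a =>
    le_of_tendsto (hsum a).hasSum.norm <| .of_forall fun F =>
      hx F _ _ (fun i _ => hcoord a i) (norm_nonneg a)
  have hT : ∀ a, HasSum (fun i => a.1 i • x i) (T a) := fun a => (hsum a).hasSum
  have hclose : ∀ a i, |f i (T a) - a.1 i| ≤ ‖a‖ / 2 := by
    intro a i
    have hlim := (((hT a).mapL (f i)).sub_const (a.1 i)).abs
    refine le_of_tendsto hlim ?_
    filter_upwards [Filter.eventually_ge_atTop {i}] with F hF
    rw [← Finset.add_sum_erase F _ (hF (Finset.mem_singleton_self i))]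
    simp only [map_smul, hfx, smul_eq_mul, mul_one, add_sub_cancel_left]
    calc |∑ j ∈ F.erase i, a.1 j * f i (x j)|
        ≤ ∑ j ∈ F.erase i, ‖a‖ * |f i (x j)| :=
          (Finset.abs_sum_le_sum_abs _ _).trans <| Finset.sum_le_sum fun j _ => by
            rw [abs_mul]
            exact mul_le_mul_of_nonneg_right (hcoord a j) (abs_nonneg _)
      _ ≤ ‖a‖ / 2 := by
          rw [← Finset.mul_sum]
          nlinarith [hoff i _ (F.notMem_erase i), norm_nonneg a]
  have hlower : ∀ a, ‖a‖ ≤ 2 * max D 0 * ‖T a‖ := by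
    intro a
    have h : ‖a.1‖ ≤ max D 0 * ‖T a‖ + ‖a‖ / 2 := by
      refine lp.norm_le_of_forall_le (by positivity) fun i => ?_
      have h1 := hclose a i
      have h2 : |f i (T a)| ≤ max D 0 * ‖T a‖ :=
        (f i).le_of_opNorm_le ((hf i).trans (le_max_left _ _)) (T a)
      have h3 := abs_sub_abs_le_abs_sub (a.1 i) (f i (T a))
      rw [abs_sub_comm] at h3
      rw [Real.norm_eq_abs]
      linarith
    have h' : ‖a‖ = ‖a.1‖ := rfl
    linarith
  have hanti : AntilipschitzWith (2 * max D 0).toNNReal T :=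
    AddMonoidHomClass.antilipschitz_of_bound T fun a => by
      rw [Real.coe_toNNReal _ (by positivity)]
      exact hlower a
  have : CompleteSpace (cZero Γ) := isClosed_cZero.completeSpace_coe
  have hrange : IsClosed (Set.range T) := hanti.isClosed_range T.uniformContinuous
  exact ⟨LinearMap.range T.toLinearMap, hrange, ⟨T.equivRange hanti.injective hrange⟩⟩

end CZero

/-! ### Norming subspaces -/

section Norming

variable {X : Type*} [NormedAddCommGroup X] [NormedSpace ℝ X] {Z : Submodule ℝ (StrongDual ℝ X)}

theorem IsNorming.eq_zero_of_forall_apply_eq_zero (hZ : IsNorming Z) {x : X}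
    (hx : ∀ f ∈ Z, f x = 0) : x = 0 := by
  obtain ⟨c, _, hc, -, h⟩ := hZ
  have hval : normingValue Z x ≤ 0 := by
    refine Real.sSup_le ?_ le_rfl
    rintro r ⟨f, hf, -, rfl⟩
    simp [hx f hf]
  have := (h x).1
  exact norm_le_zero_iff.1 (by nlinarith)

/-- The uniform boundedness principle, applied on the Banach space `Z`: this is where closedness of
`Z` matters. -/
theorem IsNorming.exists_norm_le (hZ : IsNorming Z)
    (hZclosed : IsClosed (Z : Set (StrongDual ℝ X))) {ι : Type*} (y : ι → X)
    (hy : ∀ f ∈ Z, ∃ C, ∀ i, |f (y i)| ≤ C) : ∃ C, ∀ i, ‖y i‖ ≤ C := by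
  have : CompleteSpace Z := hZclosed.completeSpace_coe
  let g : ι → Z →L[ℝ] ℝ := fun i => (NormedSpace.inclusionInDoubleDual ℝ X (y i)).comp Z.subtypeL
  have hg : ∀ f : Z, ∃ C, ∀ i, ‖g i f‖ ≤ C := fun f => hy f f.property
  obtain ⟨C, hC⟩ := banach_steinhaus (E := Z) (F := ℝ) (σ₁₂ := RingHom.id ℝ) (g := g) hg
  obtain ⟨c, _, hc, -, h⟩ := hZ
  refine ⟨max C 0 / c, fun i => (le_div_iff₀' hc).2 ((h (y i)).1.trans ?_)⟩
  refine Real.sSup_le ?_ (le_max_right _ _)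
  rintro r ⟨f, hf, hf1, rfl⟩
  have h1 := ContinuousLinearMap.le_of_opNorm_le _ ((hC i).trans (le_max_left C 0)) (⟨f, hf⟩ : Z)
  calc |f (y i)| ≤ max C 0 * ‖f‖ := h1
    _ ≤ max C 0 := mul_le_of_le_one_right (le_max_right _ _) hf1

/-- If `∑ f (x i)` converges absolutely for every `f` in a closed norming subspace, then `x`
satisfies an upper `c₀`-estimate. -/
theorem IsNorming.exists_norm_sum_smul_le (hZ : IsNorming Z)
    (hZclosed : IsClosed (Z : Set (StrongDual ℝ X))) {Γ : Type*} {x : Γ → X}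
    (hx : ∀ f ∈ Z, ∃ C, ∀ F : Finset Γ, ∑ i ∈ F, |f (x i)| ≤ C) :
    ∃ C, ∀ (F : Finset Γ) (a : Γ → ℝ) (r : ℝ), (∀ i ∈ F, |a i| ≤ r) → 0 ≤ r →
      ‖∑ i ∈ F, a i • x i‖ ≤ C * r := by
  obtain ⟨C, hC⟩ := hZ.exists_norm_le hZclosed
    (fun p : {p : Finset Γ × (Γ → ℝ) // ∀ i ∈ p.1, |p.2 i| ≤ 1} =>
      ∑ i ∈ p.1.1, p.1.2 i • x i) (by
    intro f hf
    obtain ⟨C, hC⟩ := hx f hf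
    refine ⟨C, fun p => le_trans ?_ (hC p.1.1)⟩
    rw [map_sum]
    refine (Finset.abs_sum_le_sum_abs _ _).trans (Finset.sum_le_sum fun i hi => ?_)
    rw [map_smul, smul_eq_mul, abs_mul]
    exact mul_le_of_le_one_left (abs_nonneg _) (p.2 i hi))
  refine ⟨C, fun F a r ha hr => ?_⟩
  rcases hr.eq_or_lt with rfl | hr
  · rw [Finset.sum_eq_zero fun i hi => by rw [abs_nonpos_iff.1 (ha i hi), zero_smul]]
    simp
  · -- Rescale the coefficients to the unit ball.
    have h := hC ⟨(F, fun i => r⁻¹ * a i), fun i hi => by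
      rw [abs_mul, abs_of_pos (inv_pos.2 hr)]
      exact inv_mul_le_one_of_le₀ (ha i hi) hr.le⟩
    simp only [mul_smul] at h
    rwa [← Finset.smul_sum, norm_smul, Real.norm_of_nonneg (inv_pos.2 hr).le,
      inv_mul_le_iff₀ hr, mul_comm] at h

/-- A family on which every `f ∈ Z` is absolutely summable, and which is bounded away from zero in
the sense that `f i (x i) = 1` for bounded functionals `f i` (not necessarily in `Z`), has a
subfamily of the same cardinality that spans a copy of `c₀(Γ)`. -/
theorem IsNorming.containsIsomorphicCopy_cZero [CompleteSpace X] (hZ : IsNorming Z)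
    (hZclosed : IsClosed (Z : Set (StrongDual ℝ X))) {Γ : Type*} [Infinite Γ] {x : Γ → X}
    (hx : ∀ f ∈ Z, ∃ C, ∀ F : Finset Γ, ∑ i ∈ F, |f (x i)| ≤ C)
    {f : Γ → StrongDual ℝ X} {D : ℝ} (hf : ∀ i, ‖f i‖ ≤ D) (hfx : ∀ i, f i (x i) = 1) :
    ContainsIsomorphicCopy X (cZero Γ) := by
  classical
  obtain ⟨C, hC⟩ := hZ.exists_norm_sum_smul_le hZclosed hx
  have hrow : ∀ i (F : Finset Γ), ∑ j ∈ F, |f i (x j)| ≤ D * C := by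
    intro i F
    have hD : 0 ≤ D := (norm_nonneg _).trans (hf i)
    -- Test the upper estimate on the signs of `f i (x j)`.
    have hs := hC F (fun j => if 0 ≤ f i (x j) then 1 else -1) 1
      (fun j _ => by split_ifs <;> simp) zero_le_one
    rw [mul_one] at hs
    calc ∑ j ∈ F, |f i (x j)|
        = f i (∑ j ∈ F, (if 0 ≤ f i (x j) then (1 : ℝ) else -1) • x j) := by
          rw [map_sum]
          refine Finset.sum_congr rfl fun j _ => ?_
          split_ifs with h
          · simp [abs_of_nonneg h]
          · simp [abs_of_neg (not_le.1 h)]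
      _ ≤ ‖f i‖ * _ := (le_abs_self _).trans ((f i).le_opNorm _)
      _ ≤ D * C := mul_le_mul (hf i) hs (norm_nonneg _) hD
  obtain ⟨e, he, hes⟩ := exists_injective_tsum_le (δ := ENNReal.ofReal (1 / 2))
    ENNReal.ofReal_ne_top ⌈D * C / (1 / 2)⌉₊
    (fun i j => if i = j then 0 else ENNReal.ofReal |f i (x j)|) (fun i => if_pos rfl) (by
      intro i
      rw [ENNReal.tsum_eq_iSup_sum]
      refine iSup_le fun F => ?_
      calc ∑ j ∈ F, (if i = j then 0 else ENNReal.ofReal |f i (x j)|)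
          ≤ ∑ j ∈ F, ENNReal.ofReal |f i (x j)| :=
            Finset.sum_le_sum fun j _ => by split_ifs <;> simp
        _ = ENNReal.ofReal (∑ j ∈ F, |f i (x j)|) :=
            (ENNReal.ofReal_sum_of_nonneg fun j _ => abs_nonneg _).symm
        _ ≤ ENNReal.ofReal (⌈D * C / (1 / 2)⌉₊ * (1 / 2)) :=
            ENNReal.ofReal_le_ofReal
              ((hrow i F).trans ((div_le_iff₀ (by norm_num)).1 (Nat.le_ceil _)))
        _ = _ := by rw [ENNReal.ofReal_mul (Nat.cast_nonneg _), ENNReal.ofReal_natCast])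
  refine _root_.containsIsomorphicCopy_cZero (x := x ∘ e) (f := f ∘ e) (C := C) (D := D)
    (fun F a r ha hr => ?_) (fun i => hf _) (fun i => hfx _) fun i F hi => ?_
  · have h := hC (F.map ⟨e, he⟩) (Function.extend e a 0) r
      (fun j hj => by
        obtain ⟨k, hk, rfl⟩ := Finset.mem_map.1 hj
        simpa [he.extend_apply] using ha k hk) hr
    simpa [he.extend_apply] using h
  · rw [← ENNReal.ofReal_le_ofReal_iff (by norm_num),
      ENNReal.ofReal_sum_of_nonneg fun j _ => abs_nonneg _]
    refine le_trans (Finset.sum_le_sum fun j hj => ?_) ((ENNReal.sum_le_tsum F).trans (hes i))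
    have hij : e i ≠ e j := fun h => hi (he h ▸ hj)
    simp [hij]

end Norming

/-! ### Support functions, signed measures and uncountable sets -/

section Multimeasure

variable {X : Type*} [NormedAddCommGroup X] [NormedSpace ℝ X]

theorem apply_le_supportValue {C : Set X} (hC : Bornology.IsBounded C) (f : StrongDual ℝ X)
    {x : X} (hx : x ∈ C) : f x ≤ supportValue f C :=
  le_csSup (f.lipschitz.isBounded_image hC).bddAbove ⟨x, hx, rfl⟩

theorem abs_apply_le_supportValue {C : Set X} (hC : Bornology.IsBounded C) (f : StrongDual ℝ X)
    {x : X} (hx : x ∈ C) : |f x| ≤ |supportValue f C| + |supportValue (-f) C| := by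
  have h1 := apply_le_supportValue hC f hx
  have h2 : -f x ≤ supportValue (-f) C := apply_le_supportValue hC (-f) hx
  have := le_abs_self (supportValue f C)
  have := le_abs_self (supportValue (-f) C)
  have := abs_nonneg (supportValue f C)
  have := abs_nonneg (supportValue (-f) C)
  exact abs_le.2 ⟨by linarith, by linarith⟩

theorem exists_apply_ne_zero_of_supportValue_ne_zero {C : Set X} {f : StrongDual ℝ X}
    (h : supportValue f C ≠ 0) : ∃ x ∈ C, f x ≠ 0 := by
  by_contra! h0
  refine h (le_antisymm (Real.sSup_nonpos ?_) (Real.sSup_nonneg ?_)) <;>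
  · rintro _ ⟨x, hx, rfl⟩
    simp [h0 x hx]

variable {Ω : Type*} [MeasurableSpace Ω]

theorem MeasureTheory.SignedMeasure.sum_abs_le_totalVariation (ν : SignedMeasure Ω)
    {Γ : Type*} {B : Γ → Set Ω} (hB : ∀ i, MeasurableSet (B i))
    (hd : Pairwise fun i j => Disjoint (B i) (B j))
    (F : Finset Γ) : ∑ i ∈ F, |ν (B i)| ≤ ν.totalVariation.real Set.univ := by
  calc ∑ i ∈ F, |ν (B i)| ≤ ∑ i ∈ F, ν.totalVariation.real (B i) :=
        Finset.sum_le_sum fun i _ => ν.norm_le_totalVariation (B i)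
    _ = ν.totalVariation.real (⋃ i ∈ F, B i) :=
        (measureReal_biUnion_finset (fun i _ j _ h => hd h) fun i _ => hB i).symm
    _ ≤ _ := measureReal_mono (Set.subset_univ _)

theorem nonempty_omega_one_embedding (α : Type*) [Uncountable α] :
    Nonempty (Set.Iio (ω₁ : Ordinal.{0}) ↪ α) := by
  rw [← Cardinal.lift_mk_le']
  simp

theorem exists_uncountable_setOf_le {α : Type*} [Uncountable α] (g : α → ℝ) :
    ∃ n : ℕ, Uncountable {a | g a ≤ n} := by
  by_contra! h
  have hU : (⋃ n : ℕ, {a | g a ≤ n}) = Set.univ :=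
    Set.eq_univ_of_forall fun a => Set.mem_iUnion.2 (exists_nat_ge (g a))
  have hc : (Set.univ : Set α).Countable :=
    hU ▸ Set.countable_iUnion fun n => Set.countable_coe_iff.1 (h n)
  exact Set.not_countable_univ hc

end Multimeasure

/-! ### Existence of a control measure -/

theorem theorem1p2 {X : Type*} [NormedAddCommGroup X] [NormedSpace ℝ X] [CompleteSpace X]
    {Ω : Type*} [MeasurableSpace Ω]
    (hX : ¬ ContainsIsomorphicCopy X (cZero (Set.Iio (ω₁ : Ordinal.{0}))))
    (Z : Submodule ℝ (StrongDual ℝ X)) (hZclosed : IsClosed (Z : Set (StrongDual ℝ X)))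
    (hZ : IsNorming Z)
    (M : Set Ω → Set X)
    (hMnonempty : ∀ A : Set Ω, MeasurableSet A → (M A).Nonempty)
    (hMbounded : ∀ A : Set Ω, MeasurableSet A → Bornology.IsBounded (M A))
    (hM : ∀ f ∈ Z, IsCountablyAdditive (fun A => supportValue f (M A))) :
    ∃ μ : Measure Ω, IsControlMeasure μ M := by
  choose! ν hν using hM
  -- Both `f` and `-f` are needed, as a support function bounds `f` on one side only.
  have habs : ∀ f ∈ Z, ∀ A, MeasurableSet A → ∀ x ∈ M A, |f x| ≤ |ν f A| + |ν (-f) A| := by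
    intro f hf A hA x hx
    rw [hν f hf A hA, hν (-f) (neg_mem hf) A hA]
    exact abs_apply_le_supportValue (hMbounded A hA) f hx
  obtain ⟨J, hJc, hJ⟩ := exists_countable_dominating (fun f : Z => (ν f).totalVariation) (by
    intro S hS hSd
    by_contra hunc
    have : Uncountable S := not_countable_iff.1 fun h => hunc (Set.countable_coe_iff.1 h)
    -- Every member of `S` contains a set `B` with `ν f B ≠ 0` for some `f ∈ Z`; rescaling `f` gives
    -- a functional taking the value `1` at some point of `M B`.
    have hdata : ∀ A : S, ∃ (B : Set Ω) (f : StrongDual ℝ X) (x : X),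
        B ⊆ A ∧ MeasurableSet B ∧ x ∈ M B ∧ f x = 1 := by
      intro A
      obtain ⟨hA, f, hf⟩ := hS A A.2
      rw [SignedMeasure.totalVariation_eq_variation, Ne,
        VectorMeasure.variation_apply_eq_zero hA] at hf
      push Not at hf
      obtain ⟨B, hBA, hB, hfB⟩ := hf
      rw [hν f f.2 B hB] at hfB
      obtain ⟨x, hxB, hfx⟩ := exists_apply_ne_zero_of_supportValue_ne_zero hfB
      exact ⟨B, ((f : StrongDual ℝ X) x)⁻¹ • f, x, hBA, hB, hxB, inv_mul_cancel₀ hfx⟩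
    choose B f x hBA hB hxB hfx using hdata
    have hBd : Pairwise fun i j => Disjoint (B i) (B j) := fun i j hij =>
      (hSd i.2 j.2 (Subtype.coe_ne_coe.2 hij)).mono (hBA i) (hBA j)
    -- The rescaled functionals have uniformly bounded norms on an uncountable subfamily.
    obtain ⟨n, hn⟩ := exists_uncountable_setOf_le fun A => ‖f A‖
    obtain ⟨e⟩ := nonempty_omega_one_embedding {A | ‖f A‖ ≤ n}
    have : Infinite (Set.Iio (ω₁ : Ordinal.{0})) := by
      rw [Cardinal.infinite_iff]
      simp
    refine hX (hZ.containsIsomorphicCopy_cZero hZclosed (x := fun i => x (e i))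
      (f := fun i => f (e i)) (D := n) (fun g hg => ?_) (fun i => (e i).2) fun i => hfx _)
    refine ⟨(ν g).totalVariation.real Set.univ + (ν (-g)).totalVariation.real Set.univ,
      fun F => ?_⟩
    have hd : Pairwise fun i j => Disjoint (B (e i)) (B (e j)) := fun i j hij =>
      hBd (Subtype.coe_ne_coe.2 (e.injective.ne hij))
    calc ∑ i ∈ F, |g (x (e i))| ≤ ∑ i ∈ F, (|ν g (B (e i))| + |ν (-g) (B (e i))|) :=
          Finset.sum_le_sum fun i _ => habs g hg _ (hB _) _ (hxB _)
      _ ≤ _ := by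
          rw [Finset.sum_add_distrib]
          exact add_le_add ((ν g).sum_abs_le_totalVariation (fun i => hB _) hd F)
            ((ν (-g)).sum_abs_le_totalVariation (fun i => hB _) hd F))
  have : Countable J := hJc.to_subtype
  refine ⟨(Measure.sum fun j : J => (ν j).totalVariation).toFinite, inferInstance,
    fun A hA hμA => ?_⟩
  rw [toFinite_apply_eq_zero_iff, Measure.sum_apply_eq_zero] at hμA
  have hnull : ∀ f ∈ Z, ν f A = 0 := fun f hf =>
    SignedMeasure.null_of_totalVariation_zero _ (hJ A hA (fun j hj => hμA ⟨j, hj⟩) ⟨f, hf⟩)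
  refine (hMnonempty A hA).subset_singleton_iff.1 fun x hx =>
    hZ.eq_zero_of_forall_apply_eq_zero fun f hf => ?_
  have h := habs f hf A hA x hx
  rw [hnull f hf, hnull (-f) (neg_mem hf), abs_zero, add_zero] at h
  exact abs_nonpos_iff.1 h
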